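/- Let $n\ge 0$, let $g:\{0,1\}^n\to\{0,1\}$ be any function, let $\binom{[2n]}{n}$ be the set of strings in $\{0,1\}^{2n}$ with exactly $n$ ones, and define $f:\binom{[2n]}{n}\to\{0,1\}$ by $f(x,y)=g(x)$, where $x,y$ are the first and the last $n$ bits of the input. Then 1. $D(f)=D(g)$, $R(f)=R(g)$, $R_0(f)=R_0(g)$, $Q(f)=Q(g)$, $Q_E(f)=Q_E(g)$; 2. $\deg(f)=\deg(g)$, $\widetilde{\deg}(f)=\widetilde{\deg}(g)$; 3. $bs(f)=bs(g)$ and $s(g)\le s(f)\le bs_2(g)\le 2\,s(g)^2$; 4. $C(f)=C(g)$, $UC(f)\le UC(g)\le 4\,UC(f)^2$, and $SC(f)\le SC(g)\le 4\,SC(f)^2$. The measures are defined as follows for a function $h:S\to\{0,1\}$ with $S\subseteq\{0,1\}^N$. - $D(h)$ is the least worst-case number of queries (over inputs in $S$) of a deterministic decision tree computing $h$ on $S$. $R(h)$ is the least worst-case number of queries (over inputs and random choices) of a probability distribution on decision trees that outputs $h(x)$ with probability at least $2/3$ for each $x\in S$. $R_0(h)$ is the least worst-case (over $x \in S$) expected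 number of queries of a probability distribution on decision trees that compute $h$. $Q(h)$ and $Q_E(h)$ are the least number of queries $|i,b,z\rangle\mapsto|i,b\oplus x_i,z\rangle$ (with an index value that makes no query also allowed) of a quantum query algorithm that outputs $h(x)$ with probability at least $2/3$, respectively with probability $1$, for each $x\in S$. - $\deg(h)$ and $\widetilde{\deg}(h)$ are the least degrees of a real polynomial $p$ in $N$ variables with $p(x)=h(x)$, respectively $|p(x)-h(x)|\le 1/3$, for all $x\in S$. - A sensitive block of $x\in S$ is a set $B\subseteq[N]$ such that the string $x^B$, obtained from $x$ by flipping the bits in $B$, lies in $S$ and $h(x^B)\ne h(x)$. $bs(h)$ is the maximum, over $x\in S$, of the largest number of pairwise disjoint sensitive blocks of $x$; $bs_l(h)$ is defined likewise with only blocks of size at most $l$ allowed. The sensitivity is $s(h)=bs_1(h)$ if $S=\{0,1\}^N$, and $s(h)=bs_2(h)$ if $S$ is a slice. - An assignment is a string in $\{0,1,*\}^N$; its size is its number of non-$*$ entries, and it is consistent with $x$ if it agrees with $x$ at these entries. It is a $b$-certificate if $h(x)=b$ for every $x\in S$ consistent with it, and a certificate if it is a $b$-certificate for some $b \in \{0,1\}$.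 $C(h)$ is the maximum over $x\in S$ of the least size of an $h(x)$-certificate consistent with $x$. $UC(h)$ is the least $k$ such that some collection of certificates of size at most $k$ contains, for each $x\in S$, exactly one certificate consistent with $x$. $SC(h)$ is the least $k$ such that some collection of pairs $(C,b)$, with $C$ a $b$-certificate of size at most $k$, has the property that the subcubes of the assignments $C$ partition $\{0,1\}^N$. -/

import Mathlib

open scoped ENNReal

namespace SliceComplexity

noncomputable section

/-! Boolean functions are defined on a subset `S` of a hypercube `ι → Bool`;
a function on the whole hypercube is the case `S = Set.univ`. -/

/-- The slice of weight `k`: the strings with exactly `k` ones. -/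
def slice (ι : Type) [Fintype ι] (k : ℕ) : Set (ι → Bool) :=
  {x | (Finset.univ.filter (fun i => x i = true)).card = k}

/-- A total Boolean function, regarded as a function on the domain `Set.univ`. -/
def onCube {ι : Type} (g : (ι → Bool) → Bool) : ↥(Set.univ : Set (ι → Bool)) → Bool :=
  fun x => g x.1

/-- The function `f (x, y) = g x` on the balanced slice, where `x` is the first half of the
`2 n` input bits. -/
def balancedLift {n : ℕ} (g : (Fin n → Bool) → Bool) : slice (Fin (2 * n)) n → Bool :=
  fun z => g (fun i => z.1 ⟨i.1, by omega⟩)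

/-- A bit as a real number. -/
def bit (b : Bool) : ℝ := if b then 1 else 0

/-! ### Decision trees -/

/-- Deterministic decision trees. In `node i A₀ A₁` the variable `i` is queried, and the
computation goes on with `A₀` or `A₁` if the answer is `0` or `1` respectively. -/
inductive DTree (ι : Type) : Type where
  | leaf (b : Bool) : DTree ι
  | node (i : ι) (A₀ A₁ : DTree ι) : DTree ι

/-- The output of a decision tree. -/
def DTree.output {ι : Type} : DTree ι → (ι → Bool) → Bool
  | .leaf b, _ => b
  | .node i A₀ A₁, x => if x i then A₁.output x else A₀.output x

/-- The number of queries made by a decision tree on an input. -/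
def DTree.cost {ι : Type} : DTree ι → (ι → Bool) → ℕ
  | .leaf _, _ => 0
  | .node i A₀ A₁, x => (if x i then A₁.cost x else A₀.cost x) + 1

/-- `A` computes `f`. -/
def DTree.Computes {ι : Type} {S : Set (ι → Bool)} (A : DTree ι) (f : S → Bool) : Prop :=
  ∀ x : S, A.output x.1 = f x

/-- Deterministic query complexity. -/
def detQuery {ι : Type} {S : Set (ι → Bool)} (f : S → Bool) : ℕ :=
  sInf {d | ∃ A : DTree ι, A.Computes f ∧ (⨆ x : S, A.cost x.1) = d}

/-- Bounded-error randomized query complexity: a randomized algorithm is a probability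
distribution on decision trees, it errs with probability at most `1/3` on every input of the
domain, and its cost is the number of queries in the worst case over the inputs and the
random choices. -/
def randQuery {ι : Type} {S : Set (ι → Bool)} (f : S → Bool) : ℕ :=
  sInf {d | ∃ μ : PMF (DTree ι),
    (∀ x : S, (2 / 3 : ℝ≥0∞) ≤ μ.toOuterMeasure {A | A.output x.1 = f x}) ∧
    ∀ A ∈ μ.support, ∀ x : S, A.cost x.1 ≤ d}

/-- Zero-error randomized query complexity: the least expected number of queries on the worst
input, over all probability distributions on the decision trees that compute `f`. -/
def zeroErrorQuery {ι : Type} {S : Set (ι → Bool)} (f : S → Bool) : ℝ≥0∞ :=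
  ⨅ (μ : PMF (DTree ι)) (_ : ∀ A ∈ μ.support, A.Computes f),
    ⨆ x : S, ∑' A : DTree ι, μ A * (A.cost x.1 : ℝ≥0∞)

/-! ### Quantum query algorithms -/

/-- The computational basis: an index register (`none` stands for no query), an answer bit, and
a work register of dimension `w + 1`. -/
abbrev QBasis (ι : Type) (w : ℕ) : Type := Option ι × Bool × Fin (w + 1)

/-- A quantum query algorithm: input-independent unitaries `U 0, U 1, …` that are interleaved
with queries, and the classical output attached to each outcome of the final measurement in the
computational basis. -/
structure QAlg (ι : Type) [Fintype ι] [DecidableEq ι] where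
  w : ℕ
  U : ℕ → Matrix.unitaryGroup (QBasis ι w) ℂ
  out : QBasis ι w → Bool

/-- The query `|i, b, z⟩ ↦ |i, b ⊕ x i, z⟩`, as a map on state vectors. -/
def queryOracle {ι : Type} {w : ℕ} (x : ι → Bool) (ψ : QBasis ι w → ℂ) : QBasis ι w → ℂ :=
  fun s => ψ (s.1, xor s.2.1 (s.1.elim false x), s.2.2)

/-- The state `U t · O_x · U (t - 1) ⋯ O_x · U 0 |none, 0, 0⟩` after `t` queries. -/
def QAlg.state {ι : Type} [Fintype ι] [DecidableEq ι] (A : QAlg ι) (x : ι → Bool) :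
    ℕ → QBasis ι A.w → ℂ
  | 0 => (A.U 0).1.mulVec (Pi.single (none, false, 0) 1)
  | t + 1 => (A.U (t + 1)).1.mulVec (queryOracle x (A.state x t))

/-- The probability that `A`, stopped and measured after `t` queries to `x`, outputs `b`. -/
def QAlg.prob {ι : Type} [Fintype ι] [DecidableEq ι] (A : QAlg ι) (t : ℕ) (x : ι → Bool)
    (b : Bool) : ℝ :=
  ∑ s : QBasis ι A.w, if A.out s = b then ‖A.state x t s‖ ^ 2 else 0

/-- Bounded-error quantum query complexity. -/
def quantumQuery {ι : Type} [Fintype ι] [DecidableEq ι] {S : Set (ι → Bool)}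
    (f : S → Bool) : ℕ :=
  sInf {t | ∃ A : QAlg ι, ∀ x : S, 2 / 3 ≤ A.prob t x.1 (f x)}

/-- Exact quantum query complexity. -/
def exactQuantumQuery {ι : Type} [Fintype ι] [DecidableEq ι] {S : Set (ι → Bool)}
    (f : S → Bool) : ℕ :=
  sInf {t | ∃ A : QAlg ι, ∀ x : S, A.prob t x.1 (f x) = 1}

/-! ### Degree and approximate degree -/

/-- The least degree of a real polynomial that agrees with `f` on its domain. -/
def degree {ι : Type} {S : Set (ι → Bool)} (f : S → Bool) : ℕ :=
  sInf {d | ∃ p : MvPolynomial ι ℝ,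
    (∀ x : S, MvPolynomial.eval (fun i => bit (x.1 i)) p = bit (f x)) ∧ p.totalDegree = d}

/-- The least degree of a real polynomial within `1/3` of `f` on its domain. -/
def approxDegree {ι : Type} {S : Set (ι → Bool)} (f : S → Bool) : ℕ :=
  sInf {d | ∃ p : MvPolynomial ι ℝ,
    (∀ x : S, |bit (f x) - MvPolynomial.eval (fun i => bit (x.1 i)) p| ≤ 1 / 3) ∧
    p.totalDegree = d}

/-! ### Certificates -/

/-- A string in `{0, 1, *}^ι`, with `none` for `*`. -/
abbrev Assignment (ι : Type) : Type := ι → Option Bool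

/-- The number of entries other than `*`. -/
def Assignment.size {ι : Type} [Fintype ι] (C : Assignment ι) : ℕ :=
  (Finset.univ.filter (fun i => C i ≠ none)).card

/-- `C` is consistent with `x`. -/
def Assignment.Consistent {ι : Type} (C : Assignment ι) (x : ι → Bool) : Prop :=
  ∀ i, C i ≠ none → C i = some (x i)

/-- `C` is a `b`-certificate of `f`. -/
def IsCertificate {ι : Type} {S : Set (ι → Bool)} (f : S → Bool) (b : Bool)
    (C : Assignment ι) : Prop :=
  ∀ x : S, C.Consistent x.1 → f x = b

/-- The least size of an `f x`-certificate consistent with `x`. -/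
def certAt {ι : Type} [Fintype ι] {S : Set (ι → Bool)} (f : S → Bool) (x : S) : ℕ :=
  sInf {k | ∃ C : Assignment ι, C.Consistent x.1 ∧ IsCertificate f (f x) C ∧ C.size = k}

/-- Certificate complexity. -/
def certComplexity {ι : Type} [Fintype ι] {S : Set (ι → Bool)} (f : S → Bool) : ℕ :=
  ⨆ x : S, certAt f x

/-- Unambiguous certificate complexity: each input of the domain is consistent with exactly one
certificate of the collection. -/
def unambCert {ι : Type} [Fintype ι] {S : Set (ι → Bool)} (f : S → Bool) : ℕ :=
  sInf {k | ∃ 𝒞 : Finset (Assignment ι),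
    (∀ C ∈ 𝒞, ∃ b, IsCertificate f b C) ∧
    (∀ x : S, ∃! C, C ∈ 𝒞 ∧ C.Consistent x.1) ∧
    𝒞.sup Assignment.size = k}

/-- Subcube partition complexity: the subcubes of the labelled certificates partition the whole
hypercube, not only the domain of `f`. -/
def subcubePartition {ι : Type} [Fintype ι] {S : Set (ι → Bool)} (f : S → Bool) : ℕ :=
  sInf {k | ∃ T : Finset (Assignment ι × Bool),
    (∀ P ∈ T, IsCertificate f P.2 P.1) ∧
    (∀ x : ι → Bool, ∃! P, P ∈ T ∧ P.1.Consistent x) ∧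
    T.sup (fun P => P.1.size) = k}

/-! ### Sensitivity and block sensitivity -/

/-- The string `x` with the bits at the positions in `B` flipped. -/
def flipBits {ι : Type} [DecidableEq ι] (x : ι → Bool) (B : Finset ι) : ι → Bool :=
  fun i => if i ∈ B then !(x i) else x i

/-- `B` is a sensitive block of `x`: flipping it leads to a string of the domain on which `f`
has the other value. -/
def IsSensitiveBlock {ι : Type} [DecidableEq ι] {S : Set (ι → Bool)} (f : S → Bool) (x : S)
    (B : Finset ι) : Prop :=
  ∃ h : flipBits x.1 B ∈ S, f x ≠ f ⟨flipBits x.1 B, h⟩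

/-- The maximum number of disjoint sensitive blocks of `x`. -/
def blockSensAt {ι : Type} [DecidableEq ι] {S : Set (ι → Bool)} (f : S → Bool) (x : S) : ℕ :=
  sSup {k | ∃ F : Finset (Finset ι), (F : Set (Finset ι)).PairwiseDisjoint id ∧
    (∀ B ∈ F, IsSensitiveBlock f x B) ∧ F.card = k}

/-- Block sensitivity. -/
def blockSens {ι : Type} [DecidableEq ι] {S : Set (ι → Bool)} (f : S → Bool) : ℕ :=
  ⨆ x : S, blockSensAt f x

/-- The maximum number of disjoint sensitive blocks of `x` of size at most `l`. -/
def lBlockSensAt {ι : Type} [DecidableEq ι] {S : Set (ι → Bool)} (l : ℕ) (f : S → Bool)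
    (x : S) : ℕ :=
  sSup {k | ∃ F : Finset (Finset ι), (F : Set (Finset ι)).PairwiseDisjoint id ∧
    (∀ B ∈ F, IsSensitiveBlock f x B ∧ B.card ≤ l) ∧ F.card = k}

/-- `l`-block sensitivity. -/
def lBlockSens {ι : Type} [DecidableEq ι] {S : Set (ι → Bool)} (l : ℕ) (f : S → Bool) : ℕ :=
  ⨆ x : S, lBlockSensAt l f x

/-- Sensitivity of a function on the hypercube: blocks of size at most `1`. -/
def cubeSens {ι : Type} [DecidableEq ι] (g : ↥(Set.univ : Set (ι → Bool)) → Bool) : ℕ :=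
  lBlockSens 1 g

/-- Sensitivity of a function on a slice: blocks of size at most `2`. -/
def sliceSens {ι : Type} [Fintype ι] [DecidableEq ι] {k : ℕ} (f : slice ι k → Bool) : ℕ :=
  lBlockSens 2 f

end

end SliceComplexity

open SliceComplexity

namespace SliceComplexity

/-! Each of the two functions arises from the other by substituting literals for variables. Write f
for the slice function. Then f(x, y) = g(x) uses only the first half of the input, and g(x) = f(x,
¬x), where (x, ¬x) always has exactly n ones. `Reduces` captures such a substitution, and
`reduces_fold` and `reduces_firstHalf` give the two directions.

No measure in the equalities can increase under literal substitution: trees, quantum algorithms,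
polynomials, certificates, unambiguous collections and subcube partitions are all carried along
without loss, and disjoint sensitive blocks pull back to disjoint sensitive blocks. Hence UC and SC
are in fact equal for f and g, which is stronger than the quadratic bounds. With a bound on block
size, only the growth of a preimage matters: at most a factor 2 under folding, none under the
first-half embedding. This gives s(g) ≤ s(f) ≤ bs₂(g).

The bound bs₂(g) ≤ 2 s(g)² concerns g alone. It follows from the potential s·(number of sensitive
bits) + (number of disjoint minimal sensitive pairs): while there are more than s² pairs, some bit
can be flipped so that the potential does not drop and fewer pairs remain
(`mul_card_sensBits_add_card_le`). -/

/-- The string on `ι` whose `i`-th bit is bit `r i` of `x`, negated if `σ i` holds. -/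
def pull {ι κ : Type} (r : ι → κ) (σ : ι → Bool) (x : κ → Bool) : ι → Bool :=
  fun i => xor (σ i) (x (r i))

/-- `h` is the composition of `f` with the substitution `pull r σ`. -/
def Reduces {ι κ : Type} (r : ι → κ) (σ : ι → Bool) {S : Set (ι → Bool)} {T : Set (κ → Bool)}
    (f : S → Bool) (h : T → Bool) : Prop :=
  ∀ x : T, ∃ hx : pull r σ x.1 ∈ S, f ⟨pull r σ x.1, hx⟩ = h x

/-- Mutual domination also forces both sets to be empty together, so no measure needs a proof that
its defining set is nonempty. -/
theorem sInf_eq_of_forall_exists_le {A B : Set ℕ} (hAB : ∀ a ∈ A, ∃ b ∈ B, b ≤ a)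
    (hBA : ∀ b ∈ B, ∃ a ∈ A, a ≤ b) : sInf A = sInf B := by
  have key : ∀ {A B : Set ℕ}, (∀ a ∈ A, ∃ b ∈ B, b ≤ a) → (∀ b ∈ B, ∃ a ∈ A, a ≤ b) →
      sInf B ≤ sInf A := by
    intro A B h₁ h₂
    rcases A.eq_empty_or_nonempty with rfl | hA
    · have hB : B = ∅ := Set.eq_empty_of_forall_notMem fun b hb => by
        obtain ⟨a, ha, -⟩ := h₂ b hb
        exact ha
      rw [hB]
    · obtain ⟨b, hb, hle⟩ := h₁ _ (Nat.sInf_mem hA)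
      exact (Nat.sInf_le hb).trans hle
  exact le_antisymm (key hBA hAB) (key hAB hBA)

/-! ### Deterministic and randomized query complexity -/

section Trees

variable {ι κ : Type} {r : ι → κ} {σ : ι → Bool} {S : Set (ι → Bool)} {T : Set (κ → Bool)}
  {f : S → Bool} {h : T → Bool}

/-- The decision tree that simulates a given one on the substituted input. -/
def DTree.subst (r : ι → κ) (σ : ι → Bool) : DTree ι → DTree κ
  | .leaf b => .leaf b
  | .node i A₀ A₁ =>
    .node (r i) (if σ i then A₁.subst r σ else A₀.subst r σ)
      (if σ i then A₀.subst r σ else A₁.subst r σ)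

theorem DTree.output_subst (A : DTree ι) (x : κ → Bool) :
    (A.subst r σ).output x = A.output (pull r σ x) := by
  induction A with
  | leaf b => rfl
  | node i A₀ A₁ h₀ h₁ =>
    have hp : pull r σ x i = xor (σ i) (x (r i)) := rfl
    by_cases hσ : σ i = true <;> by_cases hx : x (r i) = true <;>
      simp [subst, output, hp, hσ, hx, h₀, h₁]

theorem DTree.cost_subst (A : DTree ι) (x : κ → Bool) :
    (A.subst r σ).cost x = A.cost (pull r σ x) := by
  induction A with
  | leaf b => rfl
  | node i A₀ A₁ h₀ h₁ =>
    have hp : pull r σ x i = xor (σ i) (x (r i)) := rfl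
    by_cases hσ : σ i = true <;> by_cases hx : x (r i) = true <;>
      simp [subst, cost, hp, hσ, hx, h₀, h₁]

theorem DTree.Computes.subst {A : DTree ι} (hA : A.Computes f) (H : Reduces r σ f h) :
    (A.subst r σ).Computes h := by
  intro x
  obtain ⟨hx, e⟩ := H x
  rw [output_subst, ← e]
  exact hA ⟨_, hx⟩

theorem Reduces.exists_detQuery [Finite ι] (H : Reduces r σ f h) :
    ∀ d ∈ {d | ∃ A : DTree ι, A.Computes f ∧ (⨆ x : S, A.cost x.1) = d},
      ∃ d' ∈ {d | ∃ A : DTree κ, A.Computes h ∧ (⨆ x : T, A.cost x.1) = d}, d' ≤ d := by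
  rintro _ ⟨A, hA, rfl⟩
  refine ⟨_, ⟨A.subst r σ, hA.subst H, rfl⟩, ciSup_le' fun x => ?_⟩
  obtain ⟨hx, -⟩ := H x
  rw [DTree.cost_subst]
  -- Finiteness of `ι` is essential: an unbounded supremum in `ℕ` would default to 0.
  exact le_ciSup (f := fun x : S => A.cost x.1) (Set.finite_range _).bddAbove ⟨_, hx⟩

theorem Reduces.exists_randQuery (H : Reduces r σ f h) :
    ∀ d ∈ {d : ℕ | ∃ μ : PMF (DTree ι),
        (∀ x : S, (2 / 3 : ℝ≥0∞) ≤ μ.toOuterMeasure {A | A.output x.1 = f x}) ∧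
        ∀ A ∈ μ.support, ∀ x : S, A.cost x.1 ≤ d},
      ∃ d' ∈ {d : ℕ | ∃ μ : PMF (DTree κ),
        (∀ x : T, (2 / 3 : ℝ≥0∞) ≤ μ.toOuterMeasure {A | A.output x.1 = h x}) ∧
        ∀ A ∈ μ.support, ∀ x : T, A.cost x.1 ≤ d}, d' ≤ d := by
  rintro d ⟨μ, h₁, h₂⟩
  refine ⟨d, ⟨μ.map (DTree.subst r σ), fun x => ?_, fun A' hA' x => ?_⟩, le_rfl⟩
  · obtain ⟨hx, e⟩ := H x
    rw [PMF.toOuterMeasure_map_apply]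
    simpa only [Set.preimage_ofPred_eq, DTree.output_subst, ← e] using h₁ ⟨_, hx⟩
  · obtain ⟨hx, -⟩ := H x
    obtain ⟨A, hA, rfl⟩ := (PMF.mem_support_map_iff _ _ _).1 hA'
    rw [DTree.cost_subst]
    exact h₂ A hA ⟨_, hx⟩

theorem _root_.PMF.tsum_map_mul {α β : Type*} (μ : PMF α) (F : α → β) (c : β → ℝ≥0∞) :
    ∑' b, μ.map F b * c b = ∑' a, μ a * c (F a) := by
  classical
  simp only [PMF.map_apply, ← ENNReal.tsum_mul_right]
  rw [ENNReal.tsum_comm]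
  refine tsum_congr fun a => ?_
  rw [tsum_eq_single (F a) (by intro b hb; simp [hb])]
  simp

theorem Reduces.zeroErrorQuery_le (H : Reduces r σ f h) :
    zeroErrorQuery h ≤ zeroErrorQuery f := by
  refine le_iInf₂ fun μ hμ => iInf₂_le_of_le (μ.map (DTree.subst r σ)) ?_ ?_
  · intro A' hA'
    obtain ⟨A, hA, rfl⟩ := (PMF.mem_support_map_iff _ _ _).1 hA'
    exact (hμ A hA).subst H
  · refine iSup_le fun x => ?_
    obtain ⟨hx, -⟩ := H x
    rw [PMF.tsum_map_mul]
    simp only [DTree.cost_subst]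
    exact le_iSup (fun x : S => ∑' A : DTree ι, μ A * (A.cost x.1 : ℝ≥0∞)) ⟨_, hx⟩

end Trees

/-! ### Exact and approximate degree -/

section Degree

variable {ι κ : Type} {r : ι → κ} {σ : ι → Bool} {S : Set (ι → Bool)} {T : Set (κ → Bool)}
  {f : S → Bool} {h : T → Bool}

theorem totalDegree_aeval_le_of_totalDegree_le_one {R : Type*} [CommRing R] {α β : Type*}
    (q : α → MvPolynomial β R) (hq : ∀ i, (q i).totalDegree ≤ 1) (p : MvPolynomial α R) :
    (MvPolynomial.aeval q p).totalDegree ≤ p.totalDegree := by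
  rw [MvPolynomial.aeval_def, MvPolynomial.eval₂_eq]
  refine (MvPolynomial.totalDegree_finsetSum _ _).trans (Finset.sup_le fun m hm => ?_)
  refine (MvPolynomial.totalDegree_mul _ _).trans ?_
  rw [MvPolynomial.algebraMap_eq, MvPolynomial.totalDegree_C, zero_add]
  refine (MvPolynomial.totalDegree_finsetProd _ _).trans ?_
  refine le_trans (Finset.sum_le_sum fun i _ => ?_) (MvPolynomial.le_totalDegree hm)
  exact (MvPolynomial.totalDegree_pow _ _).trans (by nlinarith [hq i])

/-- A literal is an affine polynomial, `X` or `1 - X`, so substituting literals does not raise the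
degree. -/
theorem exists_eval_pull (r : ι → κ) (σ : ι → Bool) (p : MvPolynomial ι ℝ) :
    ∃ q : MvPolynomial κ ℝ, q.totalDegree ≤ p.totalDegree ∧ ∀ x : κ → Bool,
      MvPolynomial.eval (fun k => bit (x k)) q =
        MvPolynomial.eval (fun i => bit (pull r σ x i)) p := by
  refine ⟨MvPolynomial.aeval (fun i => if σ i then 1 - MvPolynomial.X (r i)
    else MvPolynomial.X (r i)) p, totalDegree_aeval_le_of_totalDegree_le_one _ (fun i => ?_) p,
    fun x => ?_⟩
  · split_ifs
    · exact (MvPolynomial.totalDegree_sub _ _).trans (by simp)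
    · simp
  · rw [← MvPolynomial.coe_aeval_eq_eval, ← MvPolynomial.coe_aeval_eq_eval, RingHom.coe_coe,
      RingHom.coe_coe, ← AlgHom.comp_apply, MvPolynomial.comp_aeval]
    congr 2
    funext i
    cases hσ : σ i <;> cases hx : x (r i) <;> simp [pull, bit, hσ, hx]

theorem Reduces.exists_degree (H : Reduces r σ f h) :
    ∀ d ∈ {d | ∃ p : MvPolynomial ι ℝ,
        (∀ x : S, MvPolynomial.eval (fun i => bit (x.1 i)) p = bit (f x)) ∧ p.totalDegree = d},
      ∃ d' ∈ {d | ∃ p : MvPolynomial κ ℝ,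
        (∀ x : T, MvPolynomial.eval (fun i => bit (x.1 i)) p = bit (h x)) ∧ p.totalDegree = d},
        d' ≤ d := by
  rintro _ ⟨p, hp, rfl⟩
  obtain ⟨q, hq, e⟩ := exists_eval_pull r σ p
  refine ⟨_, ⟨q, fun x => ?_, rfl⟩, hq⟩
  obtain ⟨hx, e'⟩ := H x
  rw [e, ← e']
  exact hp ⟨_, hx⟩

theorem Reduces.exists_approxDegree (H : Reduces r σ f h) :
    ∀ d ∈ {d | ∃ p : MvPolynomial ι ℝ,
        (∀ x : S, |bit (f x) - MvPolynomial.eval (fun i => bit (x.1 i)) p| ≤ 1 / 3) ∧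
        p.totalDegree = d},
      ∃ d' ∈ {d | ∃ p : MvPolynomial κ ℝ,
        (∀ x : T, |bit (h x) - MvPolynomial.eval (fun i => bit (x.1 i)) p| ≤ 1 / 3) ∧
        p.totalDegree = d}, d' ≤ d := by
  rintro _ ⟨p, hp, rfl⟩
  obtain ⟨q, hq, e⟩ := exists_eval_pull r σ p
  refine ⟨_, ⟨q, fun x => ?_, rfl⟩, hq⟩
  obtain ⟨hx, e'⟩ := H x
  rw [e, ← e']
  exact hp ⟨_, hx⟩

end Degree

/-! ### Certificates, unambiguous certificates and subcube partitions -/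

section Certificates

variable {ι κ : Type} {r : ι → κ} {σ : ι → Bool} {S : Set (ι → Bool)} {T : Set (κ → Bool)}
  {f : S → Bool} {h : T → Bool}

open Classical in
/-- The assignment that is consistent with exactly those `x` for which `C` is consistent with
`pull r σ x`, provided that there are any. -/
noncomputable def Assignment.push (r : ι → κ) (σ : ι → Bool) (C : Assignment ι) : Assignment κ :=
  fun k => if hk : ∃ i, r i = k ∧ C i ≠ none then
    (C hk.choose).map (xor (σ hk.choose)) else none

/-- When `r` identifies positions, `C` may make conflicting demands on one bit. The witness `x₀`
excludes this: every demand on bit `k` then asks for `x₀ k`, so the choice made in `push` is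
harmless. -/
theorem Assignment.consistent_push_iff {C : Assignment ι} {x₀ : κ → Bool}
    (hC : C.Consistent (pull r σ x₀)) (x : κ → Bool) :
    (C.push r σ).Consistent x ↔ C.Consistent (pull r σ x) := by
  have hpush : ∀ i, C i ≠ none → C.push r σ (r i) = some (x₀ (r i)) := by
    intro i hi
    have hk : ∃ j, r j = r i ∧ C j ≠ none := ⟨i, rfl, hi⟩
    have e := hC _ hk.choose_spec.2
    simp only [push, dif_pos hk]
    rw [e, Option.map_some, pull, hk.choose_spec.1]
    simp
  constructor
  · intro hx i hi
    have h₁ := hx (r i) (by simp [hpush i hi])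
    rw [hpush i hi, Option.some_inj] at h₁
    rw [hC i hi, pull, pull, h₁]
  · intro hx k hk
    by_cases hk' : ∃ i, r i = k ∧ C i ≠ none
    · obtain ⟨i, rfl, hi⟩ := hk'
      have h₁ := (hC i hi).symm.trans (hx i hi)
      rw [Option.some_inj, pull, pull, Bool.xor_right_inj] at h₁
      rw [hpush i hi, h₁]
    · simp [push, hk'] at hk

theorem Assignment.size_push_le [Fintype ι] [Fintype κ] (C : Assignment ι) :
    (C.push r σ).size ≤ C.size := by
  classical
  refine le_trans (Finset.card_le_card ?_) (Finset.card_image_le (f := r))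
  intro k hk
  simp only [Finset.mem_filter, Finset.mem_univ, true_and, Finset.mem_image] at hk ⊢
  by_contra hcon
  have hk' : ¬ ∃ i, r i = k ∧ C i ≠ none := fun ⟨i, h₁, h₂⟩ => hcon ⟨i, h₂, h₁⟩
  simp [push, hk'] at hk

theorem IsCertificate.push (H : Reduces r σ f h) {C : Assignment ι} {x₀ : κ → Bool}
    (hC : C.Consistent (pull r σ x₀)) {b : Bool} (hb : IsCertificate f b C) :
    IsCertificate h b (C.push r σ) := by
  intro x hx
  obtain ⟨hx', e⟩ := H x
  rw [← e]
  exact hb ⟨_, hx'⟩ ((Assignment.consistent_push_iff hC x.1).1 hx)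

/-- The full assignment given by `x` itself is a certificate, so the infimum defining `certAt` is
attained. -/
theorem certAt_set_nonempty [Fintype ι] (f : S → Bool) (x : S) :
    {k | ∃ C : Assignment ι, C.Consistent x.1 ∧ IsCertificate f (f x) C ∧ C.size = k}.Nonempty := by
  refine ⟨_, fun i => some (x.1 i), fun i _ => rfl, fun y hy => ?_, rfl⟩
  have : x = y := Subtype.ext (funext fun i => Option.some_inj.1 (hy i (by simp)))
  rw [this]

theorem Reduces.certComplexity_le [Fintype ι] [Fintype κ] (H : Reduces r σ f h) :
    certComplexity h ≤ certComplexity f := by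
  refine ciSup_le' fun x => ?_
  obtain ⟨hx, e⟩ := H x
  refine le_trans ?_ (le_ciSup (f := certAt f) (Set.finite_range _).bddAbove ⟨_, hx⟩)
  obtain ⟨C, h₁, h₂, h₃⟩ := Nat.sInf_mem (certAt_set_nonempty f ⟨_, hx⟩)
  exact le_trans (Nat.sInf_le ⟨C.push r σ, (Assignment.consistent_push_iff h₁ _).2 h₁,
    e ▸ h₂.push H h₁, rfl⟩) (C.size_push_le.trans h₃.le)

theorem Reduces.exists_unambCert [Fintype ι] [Fintype κ] (H : Reduces r σ f h) :
    ∀ d ∈ {k | ∃ 𝒞 : Finset (Assignment ι),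
        (∀ C ∈ 𝒞, ∃ b, IsCertificate f b C) ∧
        (∀ x : S, ∃! C, C ∈ 𝒞 ∧ C.Consistent x.1) ∧ 𝒞.sup Assignment.size = k},
      ∃ d' ∈ {k | ∃ 𝒞 : Finset (Assignment κ),
        (∀ C ∈ 𝒞, ∃ b, IsCertificate h b C) ∧
        (∀ x : T, ∃! C, C ∈ 𝒞 ∧ C.Consistent x.1) ∧ 𝒞.sup Assignment.size = k}, d' ≤ d := by
  classical
  rintro _ ⟨𝒞, h₁, h₂, rfl⟩
  -- Assignments consistent with no substituted string cover nothing needed, and their pushes could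
  -- cover spurious inputs, so they are dropped.
  refine ⟨_, ⟨(𝒞.filter fun C => ∃ x, C.Consistent (pull r σ x)).image
    (Assignment.push r σ), ?_, fun x => ?_, rfl⟩, ?_⟩
  · simp only [Finset.mem_image, Finset.mem_filter]
    rintro _ ⟨C, ⟨hC, x, hx⟩, rfl⟩
    obtain ⟨b, hb⟩ := h₁ C hC
    exact ⟨b, hb.push H hx⟩
  · obtain ⟨hx, -⟩ := H x
    obtain ⟨C, ⟨hC, hCx⟩, huniq⟩ := h₂ ⟨_, hx⟩
    refine ⟨C.push r σ, ⟨Finset.mem_image_of_mem _ (Finset.mem_filter.2 ⟨hC, _, hCx⟩),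
      (Assignment.consistent_push_iff hCx _).2 hCx⟩, ?_⟩
    rintro _ ⟨hC', hCx'⟩
    obtain ⟨C', hC'', rfl⟩ := Finset.mem_image.1 hC'
    obtain ⟨hC'', x', hx'⟩ := Finset.mem_filter.1 hC''
    rw [huniq C' ⟨hC'', (Assignment.consistent_push_iff hx' _).1 hCx'⟩]
  · refine Finset.sup_le fun C' hC' => ?_
    obtain ⟨C, hC, rfl⟩ := Finset.mem_image.1 hC'
    exact C.size_push_le.trans (Finset.le_sup (f := Assignment.size) (Finset.mem_filter.1 hC).1)

theorem Reduces.exists_subcubePartition [Fintype ι] [Fintype κ] (H : Reduces r σ f h) :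
    ∀ d ∈ {k | ∃ P : Finset (Assignment ι × Bool),
        (∀ C ∈ P, IsCertificate f C.2 C.1) ∧
        (∀ x : ι → Bool, ∃! C, C ∈ P ∧ C.1.Consistent x) ∧ P.sup (fun C => C.1.size) = k},
      ∃ d' ∈ {k | ∃ P : Finset (Assignment κ × Bool),
        (∀ C ∈ P, IsCertificate h C.2 C.1) ∧
        (∀ x : κ → Bool, ∃! C, C ∈ P ∧ C.1.Consistent x) ∧ P.sup (fun C => C.1.size) = k},
        d' ≤ d := by
  classical
  rintro _ ⟨P, h₁, h₂, rfl⟩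
  refine ⟨_, ⟨(P.filter fun C => ∃ x, C.1.Consistent (pull r σ x)).image
    (Prod.map (Assignment.push r σ) id), ?_, fun x => ?_, rfl⟩, ?_⟩
  · simp only [Finset.mem_image, Finset.mem_filter]
    rintro _ ⟨C, ⟨hC, x, hx⟩, rfl⟩
    exact (h₁ C hC).push H hx
  -- The partition covers the whole cube, so the substituted string need not lie in `S`.
  · obtain ⟨C, ⟨hC, hCx⟩, huniq⟩ := h₂ (pull r σ x)
    refine ⟨Prod.map (Assignment.push r σ) id C,
      ⟨Finset.mem_image_of_mem _ (Finset.mem_filter.2 ⟨hC, _, hCx⟩),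
      (Assignment.consistent_push_iff hCx _).2 hCx⟩, ?_⟩
    rintro _ ⟨hC', hCx'⟩
    obtain ⟨C', hC'', rfl⟩ := Finset.mem_image.1 hC'
    obtain ⟨hC'', x', hx'⟩ := Finset.mem_filter.1 hC''
    rw [huniq C' ⟨hC'', (Assignment.consistent_push_iff hx' _).1 hCx'⟩]
  · refine Finset.sup_le fun C' hC' => ?_
    obtain ⟨C, hC, rfl⟩ := Finset.mem_image.1 hC'
    exact C.1.size_push_le.trans
      (Finset.le_sup (f := fun C : Assignment ι × Bool => C.1.size) (Finset.mem_filter.1 hC).1)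

end Certificates

/-! ### Block sensitivity, with or without a size restriction -/

section Sensitivity

variable {ι κ : Type} [DecidableEq ι] [DecidableEq κ] {r : ι → κ} {σ : ι → Bool}
  {S : Set (ι → Bool)} {T : Set (κ → Bool)} {f : S → Bool} {h : T → Bool}

/-- The largest number of disjoint sensitive blocks of `x` that satisfy `p`. -/
noncomputable def blockSensWith (p : Finset ι → Prop) (f : S → Bool) (x : S) : ℕ :=
  sSup {k | ∃ F : Finset (Finset ι), (F : Set (Finset ι)).PairwiseDisjoint id ∧
    (∀ B ∈ F, IsSensitiveBlock f x B ∧ p B) ∧ F.card = k}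

theorem blockSensAt_eq (f : S → Bool) : blockSensAt f = blockSensWith (fun _ => True) f := by
  funext x
  simp [blockSensAt, blockSensWith]

theorem card_le_blockSensWith [Finite ι] {p : Finset ι → Prop} {x : S} {F : Finset (Finset ι)}
    (hd : (F : Set (Finset ι)).PairwiseDisjoint id)
    (hF : ∀ B ∈ F, IsSensitiveBlock f x B ∧ p B) : F.card ≤ blockSensWith p f x := by
  have := Fintype.ofFinite ι
  refine le_csSup ⟨Fintype.card (Finset ι), ?_⟩ ⟨F, hd, hF, rfl⟩
  rintro _ ⟨F', -, -, rfl⟩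
  exact Finset.card_le_univ F'

theorem blockSensWith_le_iff [Finite ι] {p : Finset ι → Prop} {x : S} {m : ℕ} :
    blockSensWith p f x ≤ m ↔ ∀ F : Finset (Finset ι), (F : Set (Finset ι)).PairwiseDisjoint id →
      (∀ B ∈ F, IsSensitiveBlock f x B ∧ p B) → F.card ≤ m := by
  refine ⟨fun hm F h₁ h₂ => (card_le_blockSensWith h₁ h₂).trans hm, fun H => csSup_le' ?_⟩
  rintro _ ⟨F, h₁, h₂, rfl⟩
  exact H F h₁ h₂

theorem IsSensitiveBlock.nonempty {x : S} {B : Finset ι} (hB : IsSensitiveBlock f x B) :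
    B.Nonempty := by
  rw [Finset.nonempty_iff_ne_empty]
  rintro rfl
  obtain ⟨h₁, h₂⟩ := hB
  apply h₂
  congr 1

theorem pull_flipBits [Fintype ι] (x : κ → Bool) (B : Finset κ) :
    pull r σ (flipBits x B) = flipBits (pull r σ x) (Finset.univ.filter fun i => r i ∈ B) := by
  funext i
  by_cases hi : r i ∈ B <;> simp [pull, flipBits, hi]

theorem Reduces.isSensitiveBlock [Fintype ι] (H : Reduces r σ f h) {x : T}
    (hx : pull r σ x.1 ∈ S) {B : Finset κ} (hB : IsSensitiveBlock h x B) :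
    IsSensitiveBlock f ⟨pull r σ x.1, hx⟩ (Finset.univ.filter fun i => r i ∈ B) := by
  obtain ⟨h₁, h₂⟩ := hB
  obtain ⟨h₃, h₄⟩ := H ⟨_, h₁⟩
  have h₅ := (H x).2
  simp only [pull_flipBits] at h₃ h₄
  exact ⟨h₃, by rwa [h₄, h₅]⟩

/-- Preimages under `r` of disjoint blocks are disjoint, and sensitive since flipping commutes with
substitution. A sensitive block is nonempty, so distinct blocks have distinct preimages and the
count survives. -/
theorem Reduces.iSup_blockSensWith_le [Fintype ι] [Finite κ] (H : Reduces r σ f h)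
    {p : Finset ι → Prop} {q : Finset κ → Prop}
    (hpq : ∀ B, q B → p (Finset.univ.filter fun i => r i ∈ B)) :
    ⨆ x, blockSensWith q h x ≤ ⨆ x, blockSensWith p f x := by
  refine ciSup_le' fun x => ?_
  obtain ⟨hx, -⟩ := H x
  refine le_trans ?_ (le_ciSup (f := blockSensWith p f) (Set.finite_range _).bddAbove ⟨_, hx⟩)
  refine blockSensWith_le_iff.2 fun F hd hF => ?_
  have hdisj : ∀ B ∈ F, ∀ B' ∈ F, B ≠ B' → Disjoint (Finset.univ.filter fun i => r i ∈ B)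
      (Finset.univ.filter fun i => r i ∈ B') := by
    intro B hB B' hB' hne
    rw [Finset.disjoint_left]
    simp only [Finset.mem_filter, Finset.mem_univ, true_and]
    exact fun i hi hi' => Finset.disjoint_left.1 (hd hB hB' hne) hi hi'
  rw [← Finset.card_image_of_injOn (s := F) (f := fun B => Finset.univ.filter fun i => r i ∈ B)]
  · refine card_le_blockSensWith ?_ ?_
    · intro _ h₁ _ h₂ hne
      obtain ⟨B, hB, rfl⟩ := Finset.mem_image.1 h₁
      obtain ⟨B', hB', rfl⟩ := Finset.mem_image.1 h₂
      exact hdisj B hB B' hB' fun e => hne (by rw [e])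
    · intro _ h₁
      obtain ⟨B, hB, rfl⟩ := Finset.mem_image.1 h₁
      exact ⟨H.isSensitiveBlock hx (hF B hB).1, hpq B (hF B hB).2⟩
  · intro B hB B' hB' e
    by_contra hne
    have h₁ := hdisj B hB B' hB' hne
    simp only at e
    rw [← e, disjoint_self] at h₁
    exact (H.isSensitiveBlock hx (hF B hB).1).nonempty.ne_empty h₁

end Sensitivity

/-! ### Quantum query complexity -/

section Quantum

open Matrix

theorem submatrix_mem_unitaryGroup {m n : Type*} [Fintype m] [DecidableEq m] [Fintype n]
    [DecidableEq n] {M : Matrix m m ℂ} (hM : M ∈ unitaryGroup m ℂ) (a b : n ≃ m) :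
    M.submatrix a b ∈ unitaryGroup n ℂ := by
  rw [mem_unitaryGroup_iff', star_eq_conjTranspose] at hM ⊢
  rw [conjTranspose_submatrix, submatrix_mul_equiv, hM, submatrix_one_equiv]

theorem fromBlocks_one_mem_unitaryGroup {m n : Type*} [Fintype m] [DecidableEq m] [Fintype n]
    [DecidableEq n] {M : Matrix m m ℂ} (hM : M ∈ unitaryGroup m ℂ) :
    fromBlocks M 0 0 (1 : Matrix n n ℂ) ∈ unitaryGroup (m ⊕ n) ℂ := by
  rw [mem_unitaryGroup_iff', star_eq_conjTranspose] at hM ⊢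
  simp [fromBlocks_conjTranspose, fromBlocks_multiply, hM]

theorem submatrix_fromBlocks_mulVec {B R B' : Type*} [Fintype B] [DecidableEq B] [Fintype R]
    [DecidableEq R] [Fintype B'] (M : Matrix B B ℂ) (a b : B' ≃ B ⊕ R) (v : B' → ℂ) (ψ : B → ℂ)
    (hv : v ∘ b.symm = Sum.elim ψ 0) :
    ((fromBlocks M 0 0 (1 : Matrix R R ℂ)).submatrix a b) *ᵥ v = Sum.elim (M *ᵥ ψ) 0 ∘ a := by
  rw [submatrix_mulVec_equiv, hv, fromBlocks_mulVec]
  simp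

theorem exists_sum_equiv_extending {B B' : Type} [Finite B'] (e : B → B')
    (he : Function.Injective e) :
    ∃ (R : Type) (_ : Fintype R) (_ : DecidableEq R) (φ : B ⊕ R ≃ B'),
      ∀ s, φ (Sum.inl s) = e s := by
  classical
  have := Fintype.ofFinite B'
  refine ⟨((Set.range e)ᶜ : Set B'), inferInstance, inferInstance,
    ((Equiv.ofInjective e he).sumCongr (Equiv.refl _)).trans (Equiv.Set.sumCompl (Set.range e)),
    fun s => ?_⟩
  simp

/-- Negation of the answer bit if the queried bit is one that is negated by the substitution. -/
def negAnswer {ι : Type} (σ : ι → Bool) (w : ℕ) : Equiv.Perm (QBasis ι w) :=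
  Function.Involutive.toPerm (fun s => (s.1, xor s.2.1 (s.1.elim false σ), s.2.2))
    fun s => by simp

theorem negAnswer_apply {ι : Type} (σ : ι → Bool) (w : ℕ) (s : QBasis ι w) :
    negAnswer σ w s = (s.1, xor s.2.1 (s.1.elim false σ), s.2.2) :=
  rfl

variable {ι κ : Type} [Fintype ι] [DecidableEq ι] [Fintype κ] [DecidableEq κ] {r : ι → κ}
  {σ : ι → Bool} {S : Set (ι → Bool)} {T : Set (κ → Bool)} {f : S → Bool} {h : T → Bool}

/-- The factor `Option ι` remembers the original query index, because `r` need not be injective. The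
normalization at 0 makes the two starting states correspond. -/
theorem exists_workRegister (w : ℕ) (ι : Type) [Fintype ι] :
    ∃ (w' : ℕ) (φ : Fin (w + 1) × Option ι ≃ Fin (w' + 1)), φ (0, none) = 0 := by
  classical
  obtain ⟨w', hw'⟩ : ∃ w', Fintype.card (Fin (w + 1) × Option ι) = w' + 1 :=
    Nat.exists_eq_succ_of_ne_zero Fintype.card_ne_zero
  let φ := Fintype.equivFinOfCardEq hw'
  exact ⟨w', φ.trans (Equiv.swap (φ (0, none)) 0), by simp⟩

/-- The state space of `A` embeds in a larger one by `e`; each unitary acts there as before and as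
the identity on the remaining basis vectors. Queries preserve the image of `e`, so the amplitudes
agree at every time. -/
theorem exists_simulation (r : ι → κ) (σ : ι → Bool) (A : QAlg ι) :
    ∃ A' : QAlg κ, ∀ t x b, A'.prob t x b = A.prob t (pull r σ x) b := by
  obtain ⟨w', enc, henc⟩ := exists_workRegister A.w ι
  let e : QBasis ι A.w → QBasis κ w' := fun s => (s.1.map r, s.2.1, enc (s.2.2, s.1))
  have he : Function.Injective e := by
    rintro ⟨i, b, z⟩ ⟨i', b', z'⟩ h
    simp only [e, Prod.mk.injEq, EmbeddingLike.apply_eq_iff_eq] at h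
    simp [h.2.1, h.2.2.1, h.2.2.2]
  obtain ⟨R, _, _, φ, hφ⟩ := exists_sum_equiv_extending e he
  -- The negations by `σ` are undone after each query by permuting the columns of the next unitary;
  -- no query precedes `U 0`.
  let π := fun t : ℕ => if t = 0 then 1 else ((negAnswer σ A.w).sumCongr (1 : Equiv.Perm R))
  let A' : QAlg κ :=
    { w := w'
      U := fun t => ⟨(fromBlocks (A.U t).1 0 0 (1 : Matrix R R ℂ)).submatrix φ.symm
          (φ.symm.trans (π t)), submatrix_mem_unitaryGroup
            (fromBlocks_one_mem_unitaryGroup (A.U t).2) _ _⟩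
      out := fun s => (φ.symm s).elim A.out fun _ => false }
  have hstate : ∀ x t, A'.state x t = Sum.elim (A.state (pull r σ x) t) 0 ∘ φ.symm := by
    intro x t
    induction t with
    | zero =>
      refine submatrix_fromBlocks_mulVec _ _ _ _ _ ?_
      have h₀ : e (none, false, 0) = (none, false, 0) := by simp [e, henc]
      funext s
      have : (Pi.single (none, false, 0) 1 : QBasis κ w' → ℂ) (φ s) =
          Sum.elim (Pi.single (none, false, 0) 1) 0 s := by
        rw [← h₀, ← hφ, Pi.single_apply]
        simp only [φ.injective.eq_iff]
        rcases s with s | s <;> simp [Pi.single_apply]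
      exact this
    | succ t ih =>
      refine submatrix_fromBlocks_mulVec _ _ _ _ _ ?_
      rw [ih]
      funext s
      rcases s with s | s
      · have h₁ : (φ.symm.trans (π (t + 1))).symm (Sum.inl s) = e (negAnswer σ A.w s) := by
          rw [← hφ]
          rfl
        rw [Function.comp_apply, h₁]
        obtain ⟨i, b, z⟩ := s
        have h₂ : ((e (negAnswer σ A.w (i, b, z))).1, xor (e (negAnswer σ A.w (i, b, z))).2.1
            ((e (negAnswer σ A.w (i, b, z))).1.elim false x), (e (negAnswer σ A.w (i, b, z))).2.2) =
            φ (Sum.inl (i, xor b (i.elim false (pull r σ x)), z)) := by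
          rw [hφ]
          cases i <;> simp [e, negAnswer_apply, pull]
        simp only [queryOracle, h₂, Function.comp_apply, Equiv.symm_apply_apply, Sum.elim_inl]
      · have h₁ : (φ.symm.trans (π (t + 1))).symm (Sum.inr s) = φ (Sum.inr s) := rfl
        rw [Function.comp_apply, h₁]
        simp only [queryOracle, Function.comp_apply, Sum.elim_inr]
        rcases h₂ : φ.symm ((φ (Sum.inr s)).1, xor (φ (Sum.inr s)).2.1
            ((φ (Sum.inr s)).1.elim false x), (φ (Sum.inr s)).2.2) with s' | s'
        -- The oracle changes only the answer bit, so it cannot move a basis vector from outside the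
        -- range of `e` into it.
        · exfalso
          rw [Equiv.symm_apply_eq, hφ] at h₂
          have h₃ : φ (Sum.inr s) = φ (Sum.inl
              (s'.1, xor s'.2.1 ((s'.1.map r).elim false x), s'.2.2)) := by
            rw [hφ]
            simp only [e, Prod.ext_iff] at h₂ ⊢
            obtain ⟨ha, hb, hc⟩ := h₂
            refine ⟨ha, ?_, ?_⟩
            · rw [← hb, ← ha]
              simp
            · exact hc
          simpa using φ.injective h₃
        · rfl
  refine ⟨A', fun t x b => ?_⟩
  have hout : ∀ s, A'.out (φ (Sum.inl s)) = A.out s := fun s => by simp [A']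
  unfold QAlg.prob
  rw [← φ.sum_comp, Fintype.sum_sum_type]
  simp [hstate, hout]

theorem Reduces.exists_quantumQuery (H : Reduces r σ f h) :
    ∀ t ∈ {t | ∃ A : QAlg ι, ∀ x : S, 2 / 3 ≤ A.prob t x.1 (f x)},
      ∃ t' ∈ {t | ∃ A : QAlg κ, ∀ x : T, 2 / 3 ≤ A.prob t x.1 (h x)}, t' ≤ t := by
  rintro t ⟨A, hA⟩
  obtain ⟨A', hA'⟩ := exists_simulation r σ A
  refine ⟨t, ⟨A', fun x => ?_⟩, le_rfl⟩
  obtain ⟨hx, e⟩ := H x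
  rw [hA', ← e]
  exact hA ⟨_, hx⟩

theorem Reduces.exists_exactQuantumQuery (H : Reduces r σ f h) :
    ∀ t ∈ {t | ∃ A : QAlg ι, ∀ x : S, A.prob t x.1 (f x) = 1},
      ∃ t' ∈ {t | ∃ A : QAlg κ, ∀ x : T, A.prob t x.1 (h x) = 1}, t' ≤ t := by
  rintro t ⟨A, hA⟩
  obtain ⟨A', hA'⟩ := exists_simulation r σ A
  refine ⟨t, ⟨A', fun x => ?_⟩, le_rfl⟩
  obtain ⟨hx, e⟩ := H x
  rw [hA', ← e]
  exact hA ⟨_, hx⟩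

end Quantum

/-! ### The bound of 2-block sensitivity by twice the squared sensitivity -/

section TwoBlocks

variable {ι : Type} [DecidableEq ι] {g : (ι → Bool) → Bool}

theorem flipBits_flipBits (x : ι → Bool) (A B : Finset ι) :
    flipBits (flipBits x A) B = flipBits x (symmDiff A B) := by
  funext i
  by_cases hA : i ∈ A <;> by_cases hB : i ∈ B <;> simp [flipBits, Finset.mem_symmDiff, hA, hB]

theorem flipBits_comm (x : ι → Bool) (A B : Finset ι) :
    flipBits (flipBits x A) B = flipBits (flipBits x B) A := by
  rw [flipBits_flipBits, flipBits_flipBits, symmDiff_comm]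

theorem flipBits_self (x : ι → Bool) (A : Finset ι) : flipBits (flipBits x A) A = x := by
  funext i
  by_cases hi : i ∈ A <;> simp [flipBits, hi]

theorem card_le_card_inter_biUnion {F : Finset (Finset ι)} {Z : Finset ι}
    (hd : (F : Set (Finset ι)).PairwiseDisjoint id) (hF : ∀ A ∈ F, (Z ∩ A).Nonempty) :
    F.card ≤ (Z ∩ F.biUnion id).card := by
  rw [Finset.inter_biUnion, Finset.card_biUnion
    (fun A hA B hB hne => (hd hA hB hne).mono Finset.inter_subset_right Finset.inter_subset_right),
    Finset.card_eq_sum_ones]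
  exact Finset.sum_le_sum fun A hA => (hF A hA).card_pos

variable [Fintype ι]

/-- The sensitive positions of `y`. -/
def sensBits (g : (ι → Bool) → Bool) (y : ι → Bool) : Finset ι :=
  Finset.univ.filter fun b => g (flipBits y {b}) ≠ g y

theorem mem_sensBits {y : ι → Bool} {b : ι} : b ∈ sensBits g y ↔ g (flipBits y {b}) ≠ g y := by
  simp [sensBits]

theorem mem_sensBits_flipBits {y : ι → Bool} {b : ι} :
    b ∈ sensBits g (flipBits y {b}) ↔ b ∈ sensBits g y := by
  rw [mem_sensBits, mem_sensBits, flipBits_self, ne_comm]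

/-- A minimal sensitive block of size two. -/
structure IsMinPair (g : (ι → Bool) → Bool) (y : ι → Bool) (A : Finset ι) : Prop where
  card_eq : A.card = 2
  sensitive : g (flipBits y A) ≠ g y
  notMem : ∀ a ∈ A, a ∉ sensBits g y

theorem IsMinPair.exists_flipBits_eq {y : ι → Bool} {A : Finset ι} (hA : IsMinPair g y A) {a : ι}
    (ha : a ∈ A) : ∃ a' ∈ A, a' ≠ a ∧ flipBits (flipBits y {a}) {a'} = flipBits y A := by
  obtain ⟨a', ha'⟩ : ∃ a', A.erase a = {a'} :=
    Finset.card_eq_one.1 (by rw [Finset.card_erase_of_mem ha, hA.card_eq])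
  have hmem : a' ∈ A.erase a := by simp [ha']
  obtain ⟨hne, hmem⟩ := Finset.mem_erase.1 hmem
  refine ⟨a', hmem, hne, ?_⟩
  rw [flipBits_flipBits, ← Finset.insert_erase ha, ha']
  congr 1
  ext i
  simp only [Finset.mem_symmDiff, Finset.mem_singleton, Finset.mem_insert]
  constructor
  · rintro (⟨h, -⟩ | ⟨h, -⟩) <;> simp [h]
  · rintro (rfl | rfl)
    · exact Or.inl ⟨rfl, hne.symm⟩
    · exact Or.inr ⟨rfl, hne⟩

/-- Unflipping one element of the pair leaves a single insensitive bit flipped, which restores the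
value at `y`. -/
theorem IsMinPair.subset_sensBits {y : ι → Bool} {A : Finset ι} (hA : IsMinPair g y A) :
    A ⊆ sensBits g (flipBits y A) := by
  intro a ha
  obtain ⟨a', ha', -, e⟩ := hA.exists_flipBits_eq ha
  have h₁ := hA.notMem a' ha'
  rw [mem_sensBits, not_not] at h₁
  rw [mem_sensBits, ← e, flipBits_comm _ {a'}, flipBits_self, h₁, e]
  exact hA.sensitive.symm

theorem sum_card_filter_comm {α β : Type*} (U : Finset α) (W : Finset β) (R : α → β → Prop)
    [∀ a b, Decidable (R a b)] :
    ∑ a ∈ U, (W.filter (R a)).card = ∑ b ∈ W, (U.filter fun a => R a b).card :=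
  Finset.sum_card_bipartiteAbove_eq_sum_card_bipartiteBelow R

/-- Average over the 2|L| bits `b` of the pairs. Let κ b count the sensitive bits `a` of `y` such
that `b` is sensitive after flipping `a`, and l b the pairs avoiding `b` after whose flip `b` is
sensitive. At each flipped string the flipped bits are themselves sensitive and not counted, which
saves 1 per bit and 2 per pair. -/
theorem exists_bit_of_sq_lt_card {s : ℕ} (hs : ∀ y, (sensBits g y).card ≤ s) {y : ι → Bool}
    {L : Finset (Finset ι)} (hd : (L : Set (Finset ι)).PairwiseDisjoint id)
    (hL : ∀ A ∈ L, IsMinPair g y A) (hlt : s ^ 2 < L.card) :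
    ∃ A₀ ∈ L, ∃ b ∈ A₀, (∀ a ∈ sensBits g y, b ∉ sensBits g (flipBits y {a})) ∧
      (L.filter fun A => b ∉ A ∧ b ∈ sensBits g (flipBits y A)).card + 1 ≤ s := by
  set U := L.biUnion id with hU
  set κ : ι → ℕ := fun b =>
    ((sensBits g y).filter fun a => b ∈ sensBits g (flipBits y {a})).card with hκ
  set l : ι → ℕ := fun b =>
    (L.filter fun A => b ∉ A ∧ b ∈ sensBits g (flipBits y A)).card with hl
  have hUcard : U.card = 2 * L.card := by
    rw [hU, Finset.card_biUnion (fun A hA B hB hne => hd hA hB hne),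
      Finset.sum_congr rfl fun A hA => show (id A).card = 2 from (hL A hA).card_eq]
    simp [mul_comm]
  have hUsens : ∀ b ∈ U, b ∉ sensBits g y := by
    intro b hb
    obtain ⟨A, hA, hbA⟩ := Finset.mem_biUnion.1 hb
    exact (hL A hA).notMem b hbA
  have hκsum : ∑ b ∈ U, κ b + (sensBits g y).card ≤ (sensBits g y).card * s := by
    rw [hκ, sum_card_filter_comm, Finset.card_eq_sum_ones, ← Finset.sum_add_distrib,
      Finset.sum_mul]
    refine Finset.sum_le_sum fun a ha => ?_
    have h₁ : a ∉ U.filter fun b => b ∈ sensBits g (flipBits y {a}) :=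
      fun h => hUsens a (Finset.mem_filter.1 h).1 ha
    rw [one_mul, ← Finset.card_insert_of_notMem h₁]
    refine (Finset.card_le_card (Finset.insert_subset (mem_sensBits_flipBits.2 ha) ?_)).trans (hs _)
    exact fun b hb => (Finset.mem_filter.1 hb).2
  have hlsum : ∑ b ∈ U, l b + 2 * L.card ≤ L.card * s := by
    rw [hl, sum_card_filter_comm, Finset.card_eq_sum_ones, Finset.mul_sum,
      ← Finset.sum_add_distrib, Finset.sum_mul]
    refine Finset.sum_le_sum fun A hA => ?_
    have h₁ : Disjoint (U.filter fun b => b ∉ A ∧ b ∈ sensBits g (flipBits y A)) A :=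
      Finset.disjoint_left.2 fun b hb => (Finset.mem_filter.1 hb).2.1
    rw [one_mul, mul_one, ← (hL A hA).card_eq, ← Finset.card_union_of_disjoint h₁]
    refine (Finset.card_le_card (Finset.union_subset ?_ (hL A hA).subset_sensBits)).trans (hs _)
    exact fun b hb => (Finset.mem_filter.1 hb).2.2
  -- The weight `s` on κ forces κ b = 0, while leaving l b ≤ s - 1.
  obtain ⟨b, hb, hle⟩ : ∃ b ∈ U, s * κ b + l b + 1 ≤ s := by
    refine Finset.exists_le_of_sum_le ?_ ?_
    · rw [← Finset.card_pos]
      omega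
    · rw [Finset.sum_add_distrib, Finset.sum_add_distrib, ← Finset.mul_sum]
      simp only [Finset.sum_const, smul_eq_mul, mul_one]
      rw [hUcard]
      have h₁ := hs y
      have h₂ : (sensBits g y).card * s ≤ s ^ 2 := by nlinarith
      have h₃ : s * ∑ b ∈ U, κ b ≤ s * L.card := Nat.mul_le_mul_left _ (by omega)
      nlinarith
  obtain ⟨A₀, hA₀, hbA₀⟩ := Finset.mem_biUnion.1 hb
  have hκb : κ b = 0 := by
    by_contra hne
    have : s * 1 ≤ s * κ b := Nat.mul_le_mul_left _ (Nat.pos_of_ne_zero hne)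
    omega
  refine ⟨A₀, hA₀, b, hbA₀, ?_, show l b + 1 ≤ s by omega⟩
  rwa [Finset.card_eq_zero, Finset.filter_eq_empty_iff] at hκb

/-- Induction on the number of pairs. With at most s² pairs the bound is immediate. Otherwise flip
the bit `b` found by averaging: all sensitive bits survive, at most s - 1 pairs are spoiled, and the
pairs meeting the new sensitive bits are traded for at least as many new sensitive bits, each worth
`s`. -/
theorem mul_card_sensBits_add_card_le {s : ℕ} (hs : ∀ y, (sensBits g y).card ≤ s) (m : ℕ) :
    ∀ (y : ι → Bool) (L : Finset (Finset ι)), L.card = m →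
      (L : Set (Finset ι)).PairwiseDisjoint id → (∀ A ∈ L, IsMinPair g y A) →
      s * (sensBits g y).card + L.card ≤ 2 * s ^ 2 := by
  induction m using Nat.strong_induction_on with
  | _ m ih =>
  rintro y L rfl hd hL
  rcases le_or_gt L.card (s ^ 2) with hle | hlt
  · have := Nat.mul_le_mul_left s (hs y)
    nlinarith
  obtain ⟨A₀, hA₀, b, hb, hκ, hl⟩ := exists_bit_of_sq_lt_card hs hd hL hlt
  set y' := flipBits y {b} with hy'
  have hgy : g y' = g y := by
    have := (hL A₀ hA₀).notMem b hb
    rwa [mem_sensBits, not_not] at this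
  set L₁ := L.filter fun A => ¬ (b ∉ A ∧ b ∈ sensBits g (flipBits y A)) with hL₁
  set F := L₁.filter fun A => (sensBits g y' ∩ A).Nonempty with hF
  set L' := L₁.filter fun A => ¬ (sensBits g y' ∩ A).Nonempty with hL'
  have hc₁ : (L.filter fun A => b ∉ A ∧ b ∈ sensBits g (flipBits y A)).card + L₁.card = L.card :=
    Finset.card_filter_add_card_filter_not _
  have hc₂ : F.card + L'.card = L₁.card := Finset.card_filter_add_card_filter_not _
  have hFL : F ⊆ L := (Finset.filter_subset _ _).trans (Finset.filter_subset _ _)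
  have hL'L : L' ⊆ L := (Finset.filter_subset _ _).trans (Finset.filter_subset _ _)
  -- After `b` is flipped, the partner of `b` in `A₀` becomes sensitive, so at least one pair is
  -- traded.
  have hA₀F : A₀ ∈ F := by
    refine Finset.mem_filter.2 ⟨Finset.mem_filter.2 ⟨hA₀, fun h => h.1 hb⟩, ?_⟩
    obtain ⟨a', ha', -, e⟩ := (hL A₀ hA₀).exists_flipBits_eq hb
    refine ⟨a', Finset.mem_inter.2 ⟨?_, ha'⟩⟩
    rw [mem_sensBits, hy', e, ← hy', hgy]
    exact (hL A₀ hA₀).sensitive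
  have hFpos : 1 ≤ F.card := Finset.card_pos.2 ⟨_, hA₀F⟩
  have hsens : (sensBits g y).card + F.card ≤ (sensBits g y').card := by
    have h₁ : F.card ≤ (sensBits g y' ∩ F.biUnion id).card :=
      card_le_card_inter_biUnion (hd.subset (by exact_mod_cast hFL))
        fun A hA => (Finset.mem_filter.1 hA).2
    have h₂ : Disjoint (sensBits g y) (sensBits g y' ∩ F.biUnion id) := by
      rw [Finset.disjoint_left]
      intro a ha ha'
      obtain ⟨A, hA, haA⟩ := Finset.mem_biUnion.1 (Finset.mem_inter.1 ha').2
      exact (hL A (hFL hA)).notMem a haA ha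
    have h₃ : sensBits g y ⊆ sensBits g y' := by
      intro a ha
      have h₄ := hκ a ha
      rw [mem_sensBits, not_not, flipBits_comm, ← hy'] at h₄
      rw [mem_sensBits] at ha ⊢
      rwa [h₄, hgy]
    calc _ ≤ (sensBits g y).card + (sensBits g y' ∩ F.biUnion id).card := by omega
      _ = _ := (Finset.card_union_of_disjoint h₂).symm
      _ ≤ _ := Finset.card_le_card (Finset.union_subset h₃ Finset.inter_subset_left)
  have hmin : ∀ A ∈ L', IsMinPair g y' A := by
    intro A hA
    obtain ⟨hA₁, hA₂⟩ := Finset.mem_filter.1 hA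
    obtain ⟨hAL, hA₁⟩ := Finset.mem_filter.1 hA₁
    have hbA : b ∉ A := by
      intro hbA
      have : A = A₀ := by
        by_contra hne
        exact Finset.disjoint_left.1 (hd hAL hA₀ hne) hbA hb
      exact hA₂ (this ▸ (Finset.mem_filter.1 hA₀F).2)
    have hbs : b ∉ sensBits g (flipBits y A) := fun h => hA₁ ⟨hbA, h⟩
    rw [mem_sensBits, not_not, flipBits_comm, ← hy'] at hbs
    refine ⟨(hL A hAL).card_eq, ?_, fun a ha ha' => hA₂ ⟨a, Finset.mem_inter.2 ⟨ha', ha⟩⟩⟩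
    rw [hbs, hgy]
    exact (hL A hAL).sensitive
  have key := ih L'.card (by omega) y' L' rfl (hd.subset (by exact_mod_cast hL'L)) hmin
  have h₁ : s * ((sensBits g y).card + F.card) ≤ s * (sensBits g y').card :=
    Nat.mul_le_mul_left _ hsens
  -- With 1 + c traded pairs the potential gains at least s(1 + c) and loses at most (s - 1) + (1 +
  -- c), a net change of at least (s - 1)c ≥ 0.
  obtain ⟨c, hc⟩ := Nat.exists_eq_add_of_le hFpos
  rw [hc] at h₁
  have h₂ : 1 * c ≤ s * c := Nat.mul_le_mul_right _ (by omega)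
  nlinarith

theorem card_sensBits_le_cubeSens (y : ι → Bool) :
    (sensBits g y).card ≤ cubeSens (onCube g) := by
  refine le_trans ?_ (le_ciSup (f := blockSensWith (fun B => B.card ≤ 1) (onCube g))
    (Set.finite_range _).bddAbove ⟨y, trivial⟩)
  rw [← Finset.card_image_of_injective (sensBits g y) (Finset.singleton_injective)]
  refine card_le_blockSensWith ?_ ?_
  · intro _ h₁ _ h₂ hne
    obtain ⟨a, -, rfl⟩ := Finset.mem_image.1 h₁
    obtain ⟨a', -, rfl⟩ := Finset.mem_image.1 h₂
    exact Finset.disjoint_singleton.2 fun e => hne (by rw [e])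
  · intro _ h₁
    obtain ⟨a, ha, rfl⟩ := Finset.mem_image.1 h₁
    exact ⟨⟨trivial, (mem_sensBits.1 ha).symm⟩, by simp⟩

/-- Blocks meeting the sensitive bits number at most |Z| ≤ s|Z|; the others are minimal pairs. Their
total is thus bounded by the potential. -/
theorem lBlockSens_two_le (g : (ι → Bool) → Bool) :
    lBlockSens 2 (onCube g) ≤ 2 * cubeSens (onCube g) ^ 2 := by
  refine ciSup_le' fun x => (blockSensWith_le_iff (p := fun B => B.card ≤ 2)).2 fun F hd hF => ?_
  set s := cubeSens (onCube g)
  set Z := sensBits g x.1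
  set F₁ := F.filter fun A => (Z ∩ A).Nonempty
  set L := F.filter fun A => ¬ (Z ∩ A).Nonempty
  have hc : F₁.card + L.card = F.card := Finset.card_filter_add_card_filter_not _
  have hs : Z.card ≤ s := card_sensBits_le_cubeSens x.1
  have h₁ : F₁.card ≤ Z.card :=
    (card_le_card_inter_biUnion (Z := Z)
      (hd.subset (by exact_mod_cast Finset.filter_subset _ _))
      fun A hA => (Finset.mem_filter.1 hA).2).trans (Finset.card_le_card Finset.inter_subset_left)
  have h₂ := mul_card_sensBits_add_card_le (g := g) (s := s) card_sensBits_le_cubeSens _ x.1 L rfl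
    (hd.subset (by exact_mod_cast Finset.filter_subset _ _)) (by
      intro A hA
      obtain ⟨hA, hA'⟩ := Finset.mem_filter.1 hA
      obtain ⟨⟨hAS, hsens⟩, hA₂⟩ := hF A hA
      have hAne := (hF A hA).1.nonempty.card_pos
      refine ⟨?_, fun e => hsens e.symm, fun a ha ha' => hA' ⟨a, Finset.mem_inter.2 ⟨ha', ha⟩⟩⟩
      by_contra hne
      obtain ⟨a, rfl⟩ := Finset.card_eq_one.1 (by omega : A.card = 1)
      exact hA' ⟨a, Finset.mem_inter.2 ⟨mem_sensBits.2 fun e => hsens e.symm, Finset.mem_singleton_self a⟩⟩)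
  have h₃ : Z.card ≤ s * Z.card := by
    rcases Nat.eq_zero_or_pos s with h0 | h0
    · rw [h0] at hs ⊢
      omega
    · exact Nat.le_mul_of_pos_left _ h0
  change s * Z.card + L.card ≤ 2 * s ^ 2 at h₂
  omega

end TwoBlocks

/-! ### The two substitutions between the cube and the balanced slice -/

variable {n : ℕ}

/-- The embedding of the first half of the positions. -/
def firstHalf (n : ℕ) (i : Fin n) : Fin (2 * n) := ⟨i.1, by omega⟩

/-- The two halves of the positions, folded onto each other. -/
def fold (n : ℕ) (j : Fin (2 * n)) : Fin n :=
  if hj : j.1 < n then ⟨j.1, hj⟩ else ⟨j.1 - n, by omega⟩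

/-- The indicator of the second half. -/
def inSecondHalf (n : ℕ) (j : Fin (2 * n)) : Bool := decide (n ≤ j.1)

theorem filter_fold_eq (n : ℕ) (i : Fin n) :
    (Finset.univ.filter fun j => fold n j = i) = {firstHalf n i, ⟨n + i.1, by omega⟩} := by
  ext j
  simp only [Finset.mem_filter, Finset.mem_univ, true_and, Finset.mem_insert,
    Finset.mem_singleton, fold, firstHalf, Fin.ext_iff]
  split_ifs with hj
  · simp only
    omega
  · simp only
    omega

/-- Each fibre of `fold` is a pair {i, n + i} carrying complementary bits, hence exactly one 1. -/
theorem pull_fold_mem_slice (x : Fin n → Bool) :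
    pull (fold n) (inSecondHalf n) x ∈ slice (Fin (2 * n)) n := by
  have h₁ : ∀ i : Fin n, ((Finset.univ.filter
      fun j => pull (fold n) (inSecondHalf n) x j = true).filter fun j => fold n j = i).card = 1 := by
    intro i
    rw [Finset.filter_filter]
    simp only [and_comm (b := fold n _ = i)]
    rw [← Finset.filter_filter, filter_fold_eq, Finset.card_eq_one]
    have hi := i.2
    have e₁ : fold n (firstHalf n i) = i := by simp [fold, firstHalf]
    have e₂ : fold n ⟨n + i.1, by omega⟩ = i := by simp [fold]
    have e₃ : inSecondHalf n (firstHalf n i) = false := by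
      simp [inSecondHalf, firstHalf, hi.not_ge]
    have e₄ : inSecondHalf n ⟨n + i.1, by omega⟩ = true := by simp [inSecondHalf]
    cases hx : x i
    · exact ⟨⟨n + i.1, by omega⟩, by simp [Finset.filter_insert, Finset.filter_singleton, pull, *]⟩
    · exact ⟨firstHalf n i, by simp [Finset.filter_insert, Finset.filter_singleton, pull, *]⟩
  change Finset.card _ = n
  rw [Finset.card_eq_sum_card_fiberwise (f := fold n) (t := Finset.univ) (by simp),
    Finset.sum_congr rfl fun i _ => h₁ i]
  simp

theorem reduces_fold (g : (Fin n → Bool) → Bool) :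
    Reduces (fold n) (inSecondHalf n) (balancedLift g) (onCube g) := by
  refine fun x => ⟨pull_fold_mem_slice x.1, congrArg g (funext fun i => ?_)⟩
  simp [pull, fold, inSecondHalf, i.2.not_ge]

theorem reduces_firstHalf (g : (Fin n → Bool) → Bool) :
    Reduces (firstHalf n) (fun _ => false) (onCube g) (balancedLift g) := by
  refine fun x => ⟨trivial, congrArg g (funext fun i => ?_)⟩
  simp [pull, firstHalf]

theorem card_filter_fold_le (B : Finset (Fin n)) :
    (Finset.univ.filter fun j => fold n j ∈ B).card ≤ 2 * B.card := by
  refine Finset.card_le_mul_card_image_of_maps_to (f := fold n) (t := B) (by simp) 2 fun i _ => ?_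
  refine (Finset.card_le_card (Finset.filter_subset_filter _ (Finset.subset_univ _))).trans ?_
  rw [filter_fold_eq]
  exact Finset.card_le_two

theorem card_filter_firstHalf_le (B : Finset (Fin (2 * n))) :
    (Finset.univ.filter fun i => firstHalf n i ∈ B).card ≤ B.card := by
  refine Finset.card_le_card_of_injOn (firstHalf n) (by simp [Set.MapsTo]) ?_
  intro i _ j _ h
  simpa [firstHalf, Fin.ext_iff] using h

end SliceComplexity

theorem mainTheorem5 (n : ℕ) (g : (Fin n → Bool) → Bool) :
    (detQuery (balancedLift g) = detQuery (onCube g) ∧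
      randQuery (balancedLift g) = randQuery (onCube g) ∧
      zeroErrorQuery (balancedLift g) = zeroErrorQuery (onCube g) ∧
      quantumQuery (balancedLift g) = quantumQuery (onCube g) ∧
      exactQuantumQuery (balancedLift g) = exactQuantumQuery (onCube g)) ∧
    (degree (balancedLift g) = degree (onCube g) ∧
      approxDegree (balancedLift g) = approxDegree (onCube g)) ∧
    (blockSens (balancedLift g) = blockSens (onCube g) ∧
      cubeSens (onCube g) ≤ sliceSens (balancedLift g) ∧
      sliceSens (balancedLift g) ≤ lBlockSens 2 (onCube g) ∧
      lBlockSens 2 (onCube g) ≤ 2 * cubeSens (onCube g) ^ 2) ∧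
    (certComplexity (balancedLift g) = certComplexity (onCube g) ∧
      unambCert (balancedLift g) ≤ unambCert (onCube g) ∧
      unambCert (onCube g) ≤ 4 * unambCert (balancedLift g) ^ 2 ∧
      subcubePartition (balancedLift g) ≤ subcubePartition (onCube g) ∧
      subcubePartition (onCube g) ≤ 4 * subcubePartition (balancedLift g) ^ 2) := by
  have H₁ := reduces_fold g
  have H₂ := reduces_firstHalf g
  have hUC : unambCert (balancedLift g) = unambCert (onCube g) :=
    sInf_eq_of_forall_exists_le H₁.exists_unambCert H₂.exists_unambCert
  have hSC : subcubePartition (balancedLift g) = subcubePartition (onCube g) :=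
    sInf_eq_of_forall_exists_le H₁.exists_subcubePartition H₂.exists_subcubePartition
  have hsq : ∀ k : ℕ, k ≤ 4 * k ^ 2 := fun k =>
    (Nat.le_self_pow two_ne_zero k).trans (Nat.le_mul_of_pos_left _ (by norm_num))
  refine ⟨⟨sInf_eq_of_forall_exists_le H₁.exists_detQuery H₂.exists_detQuery,
      sInf_eq_of_forall_exists_le H₁.exists_randQuery H₂.exists_randQuery,
      le_antisymm H₂.zeroErrorQuery_le H₁.zeroErrorQuery_le,
      sInf_eq_of_forall_exists_le H₁.exists_quantumQuery H₂.exists_quantumQuery,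
      sInf_eq_of_forall_exists_le H₁.exists_exactQuantumQuery H₂.exists_exactQuantumQuery⟩,
    ⟨sInf_eq_of_forall_exists_le H₁.exists_degree H₂.exists_degree,
      sInf_eq_of_forall_exists_le H₁.exists_approxDegree H₂.exists_approxDegree⟩,
    ⟨?_, ?_, ?_, lBlockSens_two_le g⟩,
    le_antisymm H₂.certComplexity_le H₁.certComplexity_le, hUC.le, hUC ▸ hsq _, hSC.le,
    hSC ▸ hsq _⟩
  · rw [blockSens, blockSens, blockSensAt_eq, blockSensAt_eq]
    exact le_antisymm (H₂.iSup_blockSensWith_le fun _ _ => trivial)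
      (H₁.iSup_blockSensWith_le fun _ _ => trivial)
  -- Folding turns a one-bit flip of x into a two-bit flip of (x, ¬x), which stays in the slice.
  · refine H₁.iSup_blockSensWith_le (p := fun B => B.card ≤ 2) (q := fun B => B.card ≤ 1) ?_
    exact fun B hB => (card_filter_fold_le B).trans (by omega)
  · refine H₂.iSup_blockSensWith_le (p := fun B => B.card ≤ 2) (q := fun B => B.card ≤ 2) ?_
    exact fun B hB => (card_filter_firstHalf_le B).trans hB
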